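/- For positive integers $k\le n$, the Kneser graph $KG(n,k)$ is the graph whose vertices are the $k$-element subsets of $\{1,\dots,n\}$, two of them being adjacent if they are disjoint. A graph $G$ contains a graph $H$ as a totally odd subdivision if there are an injection $\varphi\colon V(H)\to V(G)$ and, for every edge $uv$ of $H$, a path $P_{uv}$ of odd length in $G$ with endpoints $\varphi(u)$ and $\varphi(v)$, such that no vertex of $\varphi(V(H))$ is an internal vertex of any of these paths and the paths for distinct edges of $H$ are edge-disjoint and have no internal vertex in common. **Theorem.** For all integers $s\ge 8$ and $t\ge 1$, there exists a Kneser graph $G$ with chromatic number $\chi(G)=s$ that contains the complete graph $K_t$ as a totally odd subdivision. -/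

import Mathlib

/-- The Kneser graph `KG(n, k)`: its vertices are the `k`-element subsets of an `n`-element set, and
two (distinct) vertices are adjacent when they are disjoint. For `k ≥ 1` disjoint vertices are
automatically distinct; the clause `A ≠ B` only keeps the graph loopless for `k = 0`. -/
def kneserGraph (n k : ℕ) : SimpleGraph {A : Finset (Fin n) // A.card = k} where
  Adj A B := A ≠ B ∧ Disjoint A.1 B.1
  symm := ⟨fun _ _ h => ⟨h.1.symm, h.2.symm⟩⟩
  loopless := ⟨fun _ h => h.1 rfl⟩

/-- `x` is an internal vertex of the walk `p`: it lies on `p` and is not one of its endpoints.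
(Only used for walks that are paths.) -/
def IsInternalVertex {V : Type*} {G : SimpleGraph V} {a b : V} (p : G.Walk a b) (x : V) : Prop :=
  x ∈ p.support ∧ x ≠ a ∧ x ≠ b

/-- The map `φ` on vertices and the paths `P u v` in `G`, one for every edge `uv` of `H`, form a
subdivision of `H` in `G` all of whose paths have odd length. The path of an edge may be read in
either direction (`P v u` is the reverse of `P u v`), so there is one path per undirected edge. -/
structure IsTotallyOddSubdivision {W V : Type*} (H : SimpleGraph W) (G : SimpleGraph V)
    (φ : W → V) (P : ∀ u v : W, H.Adj u v → G.Walk (φ u) (φ v)) : Prop where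
  injective : Function.Injective φ
  isPath : ∀ (u v : W) (h : H.Adj u v), (P u v h).IsPath
  reverse : ∀ (u v : W) (h : H.Adj u v), P v u h.symm = (P u v h).reverse
  edgeDisjoint : ∀ (u v u' v' : W) (h : H.Adj u v) (h' : H.Adj u' v'), s(u, v) ≠ s(u', v') →
    List.Disjoint (P u v h).edges (P u' v' h').edges
  terminal_not_internal : ∀ (u v : W) (h : H.Adj u v) (w : W), ¬ IsInternalVertex (P u v h) (φ w)
  internallyDisjoint : ∀ (u v u' v' : W) (h : H.Adj u v) (h' : H.Adj u' v'),
    s(u, v) ≠ s(u', v') →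
      ∀ x : V, ¬ (IsInternalVertex (P u v h) x ∧ IsInternalVertex (P u' v' h') x)
  odd_length : ∀ (u v : W) (h : H.Adj u v), Odd (P u v h).length

/-- `G` contains `H` as a totally odd subdivision. -/
def ContainsTotallyOddSubdivision {W V : Type*} (H : SimpleGraph W) (G : SimpleGraph V) : Prop :=
  ∃ (φ : W → V) (P : ∀ u v : W, H.Adj u v → G.Walk (φ u) (φ v)), IsTotallyOddSubdivision H G φ P

/-! The Kneser graph with parameters `2k + m` and `k` has chromatic number `m + 2` for every `k ≥
1`. Fixing `m = s - 2` therefore fixes the chromatic number and leaves `k` free, and a large `k`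
makes room for any totally odd subdivision.

The lower bound on the chromatic number is combinatorial. By a mod 2 count over a triangulated
hemisphere, an antipodal sign function on signed sets alternates along some complete flag
(`exists_alternating_flag`). A colouring with too few colours gives such a sign, namely which part
of a signed set contains the smaller colour. Each sign change lowers a bounded integer potential, so
a complete flag has too many changes (`exists_disjoint_same_color`).

For the subdivision, split `2k` points into `k` pairs. The transversals of the pairs are the
vertices of a `k`-cube. Complementary transversals are adjacent, and neighbouring ones have a common
neighbour that uses one extra point (`exists_isSubdividedAntipodalCube`). Walking along the cube
costs two edges per step, and a single antipodal edge makes a path odd. Coordinates reserved for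
each pair of terminals keep the paths apart (`exists_link`, `linkRegion_unique`). -/

/-! ### Simplicial chains modulo two -/

/-- The facets of a simplex written as a list of vertices. -/
def listFacets {V : Type*} : List V → List (List V)
  | [] => []
  | x :: l => l :: (listFacets l).map (List.cons x)

/-- The simplices of the prism between a simplex and its image under `f`. -/
def listPrism {V : Type*} (f : V → V) : List V → List (List V)
  | [] => []
  | x :: l => (x :: f x :: l.map f) :: (listPrism f l).map (List.cons x)

/-- The sum modulo two of a function over a chain of simplices. -/
def chainSum {V : Type*} (L : List (List V)) (g : List V → ZMod 2) : ZMod 2 := (L.map g).sum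

section chainSum
variable {V : Type*}

@[simp] lemma chainSum_nil (g : List V → ZMod 2) : chainSum [] g = 0 := rfl

@[simp] lemma chainSum_cons (l : List V) (L : List (List V)) (g : List V → ZMod 2) :
    chainSum (l :: L) g = g l + chainSum L g := by simp [chainSum]

@[simp] lemma chainSum_append (L M : List (List V)) (g : List V → ZMod 2) :
    chainSum (L ++ M) g = chainSum L g + chainSum M g := by simp [chainSum]

@[simp] lemma chainSum_map (L : List (List V)) (f : List V → List V) (g : List V → ZMod 2) :
    chainSum (L.map f) g = chainSum L (fun l => g (f l)) := by
  simp [chainSum, Function.comp_def]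

@[simp] lemma chainSum_flatMap (L : List (List V)) (f : List V → List (List V))
    (g : List V → ZMod 2) :
    chainSum (L.flatMap f) g = chainSum L (fun l => chainSum (f l) g) := by
  induction L with
  | nil => rfl
  | cons l L ih => simp [List.flatMap_cons, ih]

lemma chainSum_add (L : List (List V)) (g g' : List V → ZMod 2) :
    chainSum L (fun l => g l + g' l) = chainSum L g + chainSum L g' := by
  simp [chainSum, List.sum_map_add]

lemma chainSum_congr {L : List (List V)} {g g' : List V → ZMod 2} (h : ∀ l ∈ L, g l = g' l) :
    chainSum L g = chainSum L g' := by
  unfold chainSum; rw [List.map_congr_left h]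

lemma exists_ne_zero_of_chainSum_ne_zero {L : List (List V)} {g : List V → ZMod 2}
    (h : chainSum L g ≠ 0) : ∃ l ∈ L, g l ≠ 0 := by
  by_contra! hc
  apply h
  rw [chainSum_congr hc]
  simp [chainSum]

lemma chainSum_listFacets_map (f : V → V) (l : List V) (g : List V → ZMod 2) :
    chainSum (listFacets (l.map f)) g = chainSum (listFacets l) (fun m => g (m.map f)) := by
  induction l generalizing g with
  | nil => rfl
  | cons x l ih => simp [listFacets, ih]

/-- The prism is a chain homotopy between `f` and the identity. -/
lemma chainSum_listPrism (f : V → V) (l : List V) (g : List V → ZMod 2) :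
    chainSum (listPrism f l) (fun m => chainSum (listFacets m) g) =
      g l + g (l.map f) + chainSum (listFacets l) (fun m => chainSum (listPrism f m) g) := by
  induction l generalizing g with
  | nil => simp [listPrism, listFacets, CharTwo.add_self_eq_zero]
  | cons x l ih =>
    simp only [listPrism, listFacets, chainSum_cons, chainSum_map, chainSum_add, List.map_cons,
      chainSum_listFacets_map, ih]
    have h2 : ∀ a : ZMod 2, a + a = 0 := CharTwo.add_self_eq_zero
    linear_combination (h2 (g (x :: l.map f)))

end chainSum

/-! ### Alternating sign sequences -/

/-- The indicator of a list of signs that alternates and starts with `b`. -/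
def alternating : Bool → List Bool → ZMod 2
  | _, [] => 1
  | b, c :: l => if c = b then alternating (!b) l else 0

/-- Deleting one vertex can leave an alternating list in two ways. If the list already alternates,
deleting an end vertex works, and the prescribed first sign `b` decides which end. If it has exactly
one repeated neighbouring sign, deleting either of the two gives the same sign list, and these
contributions cancel. -/
lemma chainSum_listFacets_alternating {V : Type*} (s : V → Bool) (b : Bool) (l : List V) :
    chainSum (listFacets l) (fun m => alternating b (m.map s)) =
      alternating b (l.map s) + alternating (!b) (l.map s) := by
  induction l generalizing b with
  | nil => simp [listFacets, alternating, CharTwo.add_self_eq_zero]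
  | cons x l ih =>
    simp only [listFacets, chainSum_cons, chainSum_map, List.map_cons, alternating]
    by_cases h : s x = b
    · simp only [h, if_true, ih, Bool.not_not]
      have h2 : ∀ a : ZMod 2, a + a = 0 := CharTwo.add_self_eq_zero
      simp only [Bool.eq_not_self, if_false]
      linear_combination (h2 (alternating b (l.map s)))
    · have h' : s x = !b := by revert h; cases s x <;> cases b <;> simp
      simp [h', chainSum]

lemma alternating_map_not (b : Bool) (l : List Bool) :
    alternating b (l.map (fun c => !c)) = alternating (!b) l := by
  induction l generalizing b with
  | nil => rfl
  | cons c l ih => cases b <;> cases c <;> simp [alternating, ih]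

/-! ### Hemispheres of the cross-polytope and flags of signed sets -/

/-- Adding the element `d` to the positive part of a signed set. -/
def addPos (d : ℕ) (x : Finset ℕ × Finset ℕ) : Finset ℕ × Finset ℕ := (insert d x.1, x.2)

/-- A hemisphere of the barycentric subdivision of the boundary of the cross-polytope on the
coordinates `0, …, d`, as a list of simplices. -/
def hemisphere : ℕ → List (List (Finset ℕ × Finset ℕ))
  | 0 => [[({0}, ∅)]]
  | d + 1 =>
    let z := hemisphere d ++ (hemisphere d).map (List.map Prod.swap)
    z.flatMap (listPrism (addPos (d + 1))) ++
      z.map (fun l => ({d + 1}, ∅) :: l.map (addPos (d + 1)))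

/-- The chain is a prism from the lower sphere `z` to its image under `addPos`, capped by a cone
with apex `({d + 1}, ∅)`. The two copies of the image of `z` cancel, and the prism and cone over the
boundary of `z` vanish because `z` is a cycle. It is a cycle since the two hemispheres composing it
have the same boundary, itself invariant under the antipodal map. -/
lemma chainSum_listFacets_hemisphere (d : ℕ) (g : List (Finset ℕ × Finset ℕ) → ZMod 2) :
    chainSum (hemisphere (d + 1)) (fun l => chainSum (listFacets l) g) =
        chainSum (hemisphere d) g + chainSum (hemisphere d) (fun l => g (l.map Prod.swap)) := by
  have h2 : ∀ a : ZMod 2, a + a = 0 := CharTwo.add_self_eq_zero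
  have key : ∀ d, (∀ g : List (Finset ℕ × Finset ℕ) → ZMod 2,
      chainSum (hemisphere d) (fun l => chainSum (listFacets l) g) +
      chainSum (hemisphere d) (fun l => chainSum (listFacets (l.map Prod.swap)) g) = 0) →
      ∀ g, chainSum (hemisphere (d + 1)) (fun l => chainSum (listFacets l) g) =
        chainSum (hemisphere d) g + chainSum (hemisphere d) (fun l => g (l.map Prod.swap)) := by
    intro d hz g
    have hz1 := hz (fun m => chainSum (listPrism (addPos (d + 1)) m) g)
    have hz2 := hz (fun m => g (({d + 1}, ∅) :: m.map (addPos (d + 1))))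
    simp only [hemisphere, chainSum_append, chainSum_flatMap, chainSum_map, chainSum_listPrism,
      chainSum_add, listFacets, chainSum_cons, chainSum_listFacets_map] at hz1 hz2 ⊢
    linear_combination hz1 + hz2 +
      h2 (chainSum (hemisphere d) fun x => g (x.map (addPos (d + 1)))) +
      h2 (chainSum (hemisphere d) fun x => g ((x.map Prod.swap).map (addPos (d + 1))))
  induction d generalizing g with
  | zero =>
    apply key
    intro g
    simp [hemisphere, listFacets, h2]
  | succ d ih =>
    apply key
    intro g
    simp only [chainSum_listFacets_map, ih, List.map_map, Prod.swap_swap_eq, List.map_id]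
    linear_combination h2 (chainSum (hemisphere d) g) +
      h2 (chainSum (hemisphere d) fun l => g (l.map Prod.swap))

/-- The number of elements of a signed set. -/
def signedCard (x : Finset ℕ × Finset ℕ) : ℕ := x.1.card + x.2.card

/-- `x` is a signed set with support in `{0, …, d}`. -/
structure IsSignedSet (d : ℕ) (x : Finset ℕ × Finset ℕ) : Prop where
  disj : Disjoint x.1 x.2
  pos : 0 < signedCard x
  fst_subset : x.1 ⊆ Finset.range (d + 1)
  snd_subset : x.2 ⊆ Finset.range (d + 1)

/-- Strict inclusion of signed sets. -/
def SignedLT (x y : Finset ℕ × Finset ℕ) : Prop := x ≤ y ∧ signedCard x < signedCard y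

lemma IsSignedSet.swap {d : ℕ} {x : Finset ℕ × Finset ℕ} (h : IsSignedSet d x) :
    IsSignedSet d x.swap :=
  ⟨h.disj.symm, (Nat.add_comm _ _).trans_gt h.pos, h.snd_subset, h.fst_subset⟩

lemma IsSignedSet.mono {d : ℕ} {x : Finset ℕ × Finset ℕ} (h : IsSignedSet d x) :
    IsSignedSet (d + 1) x :=
  ⟨h.disj, h.pos, h.fst_subset.trans (Finset.range_subset_range.2 (by omega)),
    h.snd_subset.trans (Finset.range_subset_range.2 (by omega))⟩

lemma IsSignedSet.notMem_fst {d : ℕ} {x : Finset ℕ × Finset ℕ} (h : IsSignedSet d x) :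
    d + 1 ∉ x.1 := fun hd => by simpa using h.fst_subset hd

lemma IsSignedSet.notMem_snd {d : ℕ} {x : Finset ℕ × Finset ℕ} (h : IsSignedSet d x) :
    d + 1 ∉ x.2 := fun hd => by simpa using h.snd_subset hd

lemma IsSignedSet.signedCard_addPos {d : ℕ} {x : Finset ℕ × Finset ℕ} (h : IsSignedSet d x) :
    signedCard (addPos (d + 1) x) = signedCard x + 1 := by
  simp [signedCard, addPos, Finset.card_insert_of_notMem h.notMem_fst]; omega

lemma IsSignedSet.addPos {d : ℕ} {x : Finset ℕ × Finset ℕ} (h : IsSignedSet d x) :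
    IsSignedSet (d + 1) (addPos (d + 1) x) where
  disj := Finset.disjoint_insert_left.2 ⟨h.notMem_snd, h.disj⟩
  pos := by rw [h.signedCard_addPos]; omega
  fst_subset := Finset.insert_subset (by simp) h.mono.fst_subset
  snd_subset := h.mono.snd_subset

lemma le_addPos (d : ℕ) (x : Finset ℕ × Finset ℕ) : x ≤ addPos d x :=
  ⟨Finset.subset_insert _ _, le_rfl⟩

lemma addPos_mono (d : ℕ) {x y : Finset ℕ × Finset ℕ} (h : x ≤ y) : addPos d x ≤ addPos d y :=
  ⟨Finset.insert_subset_insert _ h.1, h.2⟩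

/-- `l` is a flag of signed sets with support in `{0, …, d}`. -/
def IsFlag (d : ℕ) (l : List (Finset ℕ × Finset ℕ)) : Prop :=
  l.Pairwise SignedLT ∧ ∀ x ∈ l, IsSignedSet d x

lemma IsFlag.map_addPos {d : ℕ} {l : List (Finset ℕ × Finset ℕ)} (h : IsFlag d l) :
    IsFlag (d + 1) (l.map (addPos (d + 1))) := by
  refine ⟨?_, fun y hy => by
    obtain ⟨x, hx, rfl⟩ := List.mem_map.1 hy; exact (h.2 x hx).addPos⟩
  rw [List.pairwise_map]
  refine h.1.imp_of_mem fun {x y} hx hy hxy => ⟨addPos_mono _ hxy.1, ?_⟩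
  rw [(h.2 x hx).signedCard_addPos, (h.2 y hy).signedCard_addPos]
  have := hxy.2; omega

lemma IsFlag.map_swap {d : ℕ} {l : List (Finset ℕ × Finset ℕ)} (h : IsFlag d l) :
    IsFlag d (l.map Prod.swap) := by
  refine ⟨?_, ?_⟩
  · rw [List.pairwise_map]
    refine h.1.imp fun {x y} hxy => ⟨⟨hxy.1.2, hxy.1.1⟩, ?_⟩
    have := hxy.2
    simp [signedCard] at *; omega
  · intro x hx
    obtain ⟨y, hy, rfl⟩ := List.mem_map.1 hx
    exact (h.2 y hy).swap

lemma mem_listPrism_subset {V : Type*} {f : V → V} {l m : List V} (hm : m ∈ listPrism f l) :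
    ∀ y ∈ m, y ∈ l ∨ ∃ x ∈ l, y = f x := by
  induction l generalizing m with
  | nil => simp [listPrism] at hm
  | cons x l ih =>
    simp only [listPrism, List.mem_cons, List.mem_map] at hm
    rcases hm with rfl | ⟨m, hm, rfl⟩
    · intro y hy
      simp only [List.mem_cons, List.mem_map] at hy ⊢
      rcases hy with rfl | rfl | ⟨z, hz, rfl⟩
      · simp
      · exact Or.inr ⟨x, by simp⟩
      · exact Or.inr ⟨z, by simp [hz]⟩
    · intro y hy
      rcases List.mem_cons.1 hy with rfl | hy
      · simp
      · rcases ih hm y hy with h | ⟨z, hz, rfl⟩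
        · simp [h]
        · exact Or.inr ⟨z, by simp [hz]⟩

lemma length_of_mem_listPrism {V : Type*} {f : V → V} {l m : List V} (hm : m ∈ listPrism f l) :
    m.length = l.length + 1 := by
  induction l generalizing m with
  | nil => simp [listPrism] at hm
  | cons x l ih =>
    simp only [listPrism, List.mem_cons, List.mem_map] at hm
    rcases hm with rfl | ⟨m, hm, rfl⟩
    · simp
    · simp [ih hm]

lemma IsSignedSet.signedLT_addPos {d : ℕ} {x y : Finset ℕ × Finset ℕ} (hy : IsSignedSet d y)
    (h : x ≤ y) (hc : signedCard x ≤ signedCard y) : SignedLT x (_root_.addPos (d + 1) y) :=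
  ⟨h.trans (le_addPos _ _), by rw [hy.signedCard_addPos]; omega⟩

lemma IsFlag.listPrism {d : ℕ} {l m : List (Finset ℕ × Finset ℕ)} (h : IsFlag d l)
    (hm : m ∈ listPrism (addPos (d + 1)) l) : IsFlag (d + 1) m := by
  induction l generalizing m with
  | nil => simp [_root_.listPrism] at hm
  | cons x l ih =>
    have hl : IsFlag d l := ⟨h.1.of_cons, fun y hy => h.2 y (by simp [hy])⟩
    have hx : IsSignedSet d x := h.2 x (by simp)
    have hxl := (List.pairwise_cons.1 h.1).1
    simp only [_root_.listPrism, List.mem_cons, List.mem_map] at hm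
    rcases hm with rfl | ⟨m, hm, rfl⟩
    · have h' := h.map_addPos
      refine ⟨List.pairwise_cons.2 ⟨?_, h'.1⟩, ?_⟩
      · intro y hy
        rw [← List.map_cons (f := addPos (d + 1))] at hy
        obtain ⟨z, hz, rfl⟩ := List.mem_map.1 hy
        rcases List.mem_cons.1 hz with rfl | hz'
        · exact hx.signedLT_addPos le_rfl le_rfl
        · exact (h.2 z hz).signedLT_addPos (hxl z hz').1 (hxl z hz').2.le
      · intro y hy
        rcases List.mem_cons.1 hy with rfl | hy
        · exact hx.mono
        · exact h'.2 y hy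
    · have hm' := ih hl hm
      refine ⟨List.pairwise_cons.2 ⟨?_, hm'.1⟩, ?_⟩
      · intro y hy
        rcases mem_listPrism_subset hm y hy with hy | ⟨z, hz, rfl⟩
        · exact hxl y hy
        · exact (hl.2 z hz).signedLT_addPos (hxl z hz).1 (hxl z hz).2.le
      · intro y hy
        rcases List.mem_cons.1 hy with rfl | hy
        · exact hx.mono
        · exact hm'.2 y hy

lemma isFlag_of_mem_hemisphere {d : ℕ} {l : List (Finset ℕ × Finset ℕ)} (hl : l ∈ hemisphere d) :
    IsFlag d l ∧ l.length = d + 1 := by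
  induction d generalizing l with
  | zero =>
    simp only [hemisphere, List.mem_singleton] at hl
    subst hl
    refine ⟨⟨by simp, ?_⟩, rfl⟩
    intro x hx
    obtain rfl := List.mem_singleton.1 hx
    exact ⟨by simp, by simp [signedCard], by simp, by simp⟩
  | succ d ih =>
    have hz : ∀ m ∈ hemisphere d ++ (hemisphere d).map (List.map Prod.swap),
        IsFlag d m ∧ m.length = d + 1 := by
      intro m hm
      rcases List.mem_append.1 hm with hm | hm
      · exact ih hm
      · obtain ⟨m', hm', rfl⟩ := List.mem_map.1 hm
        exact ⟨(ih hm').1.map_swap, by simp [(ih hm').2]⟩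
    simp only [hemisphere] at hl
    rcases List.mem_append.1 hl with hl | hl
    · obtain ⟨m, hm, hlm⟩ := List.mem_flatMap.1 hl
      exact ⟨(hz m hm).1.listPrism hlm, by rw [length_of_mem_listPrism hlm, (hz m hm).2]⟩
    · obtain ⟨m, hm, rfl⟩ := List.mem_map.1 hl
      have h' := (hz m hm).1.map_addPos
      refine ⟨⟨List.pairwise_cons.2 ⟨?_, h'.1⟩, ?_⟩, by simp [(hz m hm).2]⟩
      · intro y hy
        obtain ⟨z, hzm, rfl⟩ := List.mem_map.1 hy
        have hs := (hz m hm).1.2 z hzm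
        refine ⟨⟨by simp [addPos], by simp⟩, ?_⟩
        rw [hs.signedCard_addPos]
        have := hs.pos
        simp [signedCard] at *; omega
      · intro y hy
        rcases List.mem_cons.1 hy with rfl | hy
        · exact ⟨by simp, by simp [signedCard], by simp, by simp⟩
        · exact h'.2 y hy

/-- A form of Fan's lemma: an antipodal sign function on the signed subsets of `{0, …, d}` alternates
along some complete flag. -/
theorem exists_alternating_flag (d : ℕ) (s : Finset ℕ × Finset ℕ → Bool)
    (hs : ∀ x, IsSignedSet d x → s x.swap = !s x) :
    ∃ l b, IsFlag d l ∧ l.length = d + 1 ∧ alternating b (l.map s) ≠ 0 := by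
  -- The number of alternating simplices of a hemisphere is odd. Counting facets that alternate from
  -- `true` moves the count to the boundary sphere, and antipodality turns the opposite half of that
  -- sphere into a count from `false` on the lower hemisphere. The restriction `e ≤ d` keeps to the
  -- range where `hs` is known.
  have key : ∀ e ≤ d, chainSum (hemisphere e)
      (fun l => alternating true (l.map s) + alternating false (l.map s)) = 1 := by
    intro e he
    induction e with
    | zero => cases h : s ({0}, ∅) <;> simp [hemisphere, alternating, h]
    | succ e ih =>
      rw [← ih (by omega)]
      have h1 : ∀ l, alternating true (List.map s l) + alternating false (List.map s l) =
          chainSum (listFacets l) (fun m => alternating true (m.map s)) :=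
        fun l => (chainSum_listFacets_alternating s true l).symm
      rw [chainSum_congr (fun l _ => h1 l), chainSum_listFacets_hemisphere, ← chainSum_add]
      refine chainSum_congr fun l hl => ?_
      have hfl := (isFlag_of_mem_hemisphere hl).1
      have : (l.map Prod.swap).map s = (l.map s).map (fun c => !c) := by
        rw [List.map_map, List.map_map]
        refine List.map_congr_left fun x hx => ?_
        have hx' : IsSignedSet d x := Nat.le_induction (hfl.2 x hx) (fun _ _ h => h.mono) d
          (show e ≤ d by omega)
        exact hs x hx'
      rw [this, alternating_map_not]
      rfl
  have h1 := key d le_rfl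
  obtain ⟨l, hl, hne⟩ := exists_ne_zero_of_chainSum_ne_zero (h1 ▸ one_ne_zero)
  have := isFlag_of_mem_hemisphere hl
  by_cases h : alternating true (l.map s) = 0
  · exact ⟨l, false, this.1, this.2, by simpa [h] using hne⟩
  · exact ⟨l, true, this.1, this.2, h⟩

/-! ### The chromatic number of Kneser graphs -/

/-- The least colour of a `k`-element subset of `A`. -/
noncomputable def leastColor (c : Finset ℕ → ℕ) (k : ℕ) (A : Finset ℕ) : ℕ∞ :=
  (A.powersetCard k).inf fun K => (c K : ℕ∞)

/-- Whether the positive part of `x` has the smaller least colour, ties being broken by the least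
element. -/
noncomputable def colorSign (c : Finset ℕ → ℕ) (k : ℕ) (x : Finset ℕ × Finset ℕ) : Bool :=
  decide (toLex (leastColor c k x.1, x.1.min) < toLex (leastColor c k x.2, x.2.min))

/-- A quantity that decreases along a flag whenever `colorSign` changes. -/
noncomputable def colorPotential (c : Finset ℕ → ℕ) (k m : ℕ) (x : Finset ℕ × Finset ℕ) : ℕ∞ :=
  if signedCard x + 1 < 2 * k then ((2 * k - 2 - signedCard x + (m + 1) : ℕ) : ℕ∞)
  else min (leastColor c k x.1) (leastColor c k x.2)

/-- The two parts are disjoint and not both empty, so their least elements differ and the tie-break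
is always decisive. -/
lemma colorSign_swap (c : Finset ℕ → ℕ) (k : ℕ) {d : ℕ} {x : Finset ℕ × Finset ℕ}
    (hx : IsSignedSet d x) : colorSign c k x.swap = !colorSign c k x := by
  have hne : x.1.min ≠ x.2.min := by
    intro h
    rcases x.1.eq_empty_or_nonempty with h1 | h1
    · rw [h1, Finset.min_empty, eq_comm, Finset.min_eq_top] at h
      have := hx.pos
      simp [signedCard, h1, h] at this
    · obtain ⟨a, ha⟩ := Finset.min_of_nonempty h1
      exact Finset.disjoint_left.1 hx.disj (Finset.mem_of_min ha) (Finset.mem_of_min (h ▸ ha))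
  have hne' : toLex (leastColor c k x.1, x.1.min) ≠ toLex (leastColor c k x.2, x.2.min) :=
    fun h => hne (congrArg (fun z => (ofLex z).2) h)
  simp only [colorSign, Prod.fst_swap, Prod.snd_swap, ← decide_not, not_lt]
  exact decide_eq_decide.2 ⟨le_of_lt, fun h => lt_of_le_of_ne h hne'.symm⟩

lemma exists_leastColor_eq {c : Finset ℕ → ℕ} {k : ℕ} {A : Finset ℕ} (h : leastColor c k A ≠ ⊤) :
    ∃ K ⊆ A, K.card = k ∧ leastColor c k A = c K := by
  have hne : (A.powersetCard k).Nonempty := by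
    rw [Finset.nonempty_iff_ne_empty]
    intro h0
    exact h (by rw [leastColor, h0, Finset.inf_empty])
  obtain ⟨K, hK, he⟩ := Finset.exists_mem_eq_inf _ hne fun K => (c K : ℕ∞)
  rw [Finset.mem_powersetCard] at hK
  exact ⟨K, hK.1, hK.2, he⟩

lemma leastColor_anti (c : Finset ℕ → ℕ) (k : ℕ) {A B : Finset ℕ} (h : A ⊆ B) :
    leastColor c k B ≤ leastColor c k A :=
  Finset.inf_mono (Finset.powersetCard_mono h)

lemma leastColor_lt {c : Finset ℕ → ℕ} {k m : ℕ} {U A : Finset ℕ}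
    (hc : ∀ K ⊆ U, K.card = k → c K < m + 1) (hA : A ⊆ U) (h : k ≤ A.card) :
    leastColor c k A < (m + 1 : ℕ) := by
  obtain ⟨K, hK, hk⟩ := Finset.exists_subset_card_eq h
  refine lt_of_le_of_lt (Finset.inf_le (Finset.mem_powersetCard.2 ⟨hK, hk⟩)) ?_
  exact_mod_cast hc K (hK.trans hA) hk

lemma min_leastColor_lt {c : Finset ℕ → ℕ} {k m d : ℕ} {x : Finset ℕ × Finset ℕ}
    (hc : ∀ K ⊆ Finset.range (d + 1), K.card = k → c K < m + 1) (hx : IsSignedSet d x)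
    (h : ¬ signedCard x + 1 < 2 * k) :
    min (leastColor c k x.1) (leastColor c k x.2) < (m + 1 : ℕ) := by
  rw [signedCard] at h
  rcases le_or_gt k x.1.card with h1 | h1
  · exact min_lt_of_left_lt (leastColor_lt hc hx.fst_subset h1)
  · exact min_lt_of_right_lt (leastColor_lt hc hx.snd_subset (by omega))

lemma leastColor_le_of_colorSign {c : Finset ℕ → ℕ} {k : ℕ} {x : Finset ℕ × Finset ℕ}
    (h : colorSign c k x = true) : leastColor c k x.1 ≤ leastColor c k x.2 := by
  have := of_decide_eq_true h
  rw [Prod.Lex.toLex_lt_toLex] at this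
  rcases this with h | h
  · exact h.le
  · exact h.1.le

lemma leastColor_le_of_not_colorSign {c : Finset ℕ → ℕ} {k : ℕ} {x : Finset ℕ × Finset ℕ}
    (h : colorSign c k x = false) : leastColor c k x.2 ≤ leastColor c k x.1 := by
  have := of_decide_eq_false h
  rw [Prod.Lex.toLex_lt_toLex] at this
  by_contra! hc
  exact this (Or.inl hc)

/-- Below `2 * k - 1` elements the potential falls with size and stays at least `m + 1`. From there
on some part contains a `k`-set, so the potential is a colour, at most `m`, and cannot increase. If
it were unchanged while the sign flips, the same colour would occur in one part of `x` and in the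
opposite part of `y`, hence on two disjoint sets. -/
lemma colorPotential_lt {c : Finset ℕ → ℕ} {k m d : ℕ} {x y : Finset ℕ × Finset ℕ}
    (hc : ∀ K ⊆ Finset.range (d + 1), K.card = k → c K < m + 1)
    (hdisj : ∀ K ⊆ Finset.range (d + 1), K.card = k → ∀ L ⊆ Finset.range (d + 1), L.card = k →
      Disjoint K L → c K ≠ c L)
    (hx : IsSignedSet d x) (hy : IsSignedSet d y) (hxy : SignedLT x y)
    (hs : colorSign c k x ≠ colorSign c k y) : colorPotential c k m y < colorPotential c k m x := by
  have hlt := hxy.2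
  unfold colorPotential
  by_cases hy2 : signedCard y + 1 < 2 * k
  · rw [if_pos hy2, if_pos (by omega)]
    exact_mod_cast (by omega)
  · rw [if_neg hy2]
    have hly := min_leastColor_lt hc hy hy2
    by_cases hx2 : signedCard x + 1 < 2 * k
    · rw [if_pos hx2]
      exact hly.trans_le (by exact_mod_cast (by omega))
    rw [if_neg hx2]
    have hlx := min_leastColor_lt hc hx hx2
    have h1 := leastColor_anti c k hxy.1.1
    have h2 := leastColor_anti c k hxy.1.2
    refine lt_of_le_of_ne (min_le_min h1 h2) fun he => ?_
    have main : ∀ A B : Finset ℕ, A ⊆ Finset.range (d + 1) → B ⊆ Finset.range (d + 1) →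
        Disjoint A B → leastColor c k A < (m + 1 : ℕ) → leastColor c k B ≠ leastColor c k A := by
      intro A B hA hB hAB hl heq
      obtain ⟨K, hK, hk, hcK⟩ := exists_leastColor_eq (ne_top_of_lt hl)
      obtain ⟨L, hL, hl', hcL⟩ := exists_leastColor_eq (ne_top_of_lt (heq ▸ hl))
      refine hdisj K (hK.trans hA) hk L (hL.trans hB) hl'
        (Finset.disjoint_of_subset_left hK (Finset.disjoint_of_subset_right hL hAB)) ?_
      rw [hcK, hcL] at heq
      exact_mod_cast heq.symm
    cases hsx : colorSign c k x
    · have hsy : colorSign c k y = true := by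
        rw [hsx] at hs; revert hs; cases colorSign c k y <;> simp
      rw [min_eq_right (leastColor_le_of_not_colorSign hsx)] at he hlx
      rw [min_eq_left (leastColor_le_of_colorSign hsy)] at he
      exact main x.2 y.1 hx.snd_subset hy.fst_subset
        (Finset.disjoint_of_subset_left hxy.1.2 hy.disj.symm) hlx he
    · have hsy : colorSign c k y = false := by
        rw [hsx] at hs; revert hs; cases colorSign c k y <;> simp
      rw [min_eq_left (leastColor_le_of_colorSign hsx)] at he hlx
      rw [min_eq_right (leastColor_le_of_not_colorSign hsy)] at he
      exact main x.1 y.2 hx.fst_subset hy.snd_subset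
        (Finset.disjoint_of_subset_left hxy.1.1 hy.disj) hlx he

/-- A colouring of the `k`-subsets of a `2k + m`-set with `m + 1` colours has two disjoint sets of
the same colour. -/
theorem exists_disjoint_same_color {k m : ℕ} (hk : 1 ≤ k) (c : Finset ℕ → ℕ)
    (hc : ∀ K ⊆ Finset.range (2 * k + m), K.card = k → c K < m + 1) :
    ∃ K ⊆ Finset.range (2 * k + m), K.card = k ∧ ∃ L ⊆ Finset.range (2 * k + m), L.card = k ∧
      Disjoint K L ∧ c K = c L := by
  by_contra! hdisj
  obtain ⟨d, hd⟩ : ∃ d, 2 * k + m = d + 1 := ⟨2 * k + m - 1, by omega⟩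
  rw [hd] at hc hdisj
  obtain ⟨l, b, hl, hlen, hne⟩ := exists_alternating_flag d (colorSign c k)
    fun x hx => colorSign_swap c k hx
  -- Every step of an alternating flag changes the sign, so the potential at its head is at least
  -- the number of steps.
  have key : ∀ (l : List (Finset ℕ × Finset ℕ)) (x : Finset ℕ × Finset ℕ) (b : Bool),
      IsFlag d (x :: l) → alternating b ((x :: l).map (colorSign c k)) ≠ 0 →
      (l.length : ℕ∞) ≤ colorPotential c k m x := by
    intro l
    induction l with
    | nil => simp
    | cons y l ih =>
      intro x b hfl ha
      simp only [List.map_cons, alternating] at ha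
      by_cases hxb : colorSign c k x = b
      swap
      · simp [hxb] at ha
      by_cases hyb : colorSign c k y = !b
      swap
      · simp [hyb] at ha
      rw [if_pos hxb] at ha
      have hfl' : IsFlag d (y :: l) := ⟨hfl.1.of_cons, fun z hz => hfl.2 z (by simp_all)⟩
      have h1 := ih y (!b) hfl' ha
      have h2 := colorPotential_lt (m := m) hc hdisj (hfl.2 x (by simp)) (hfl.2 y (by simp))
        ((List.pairwise_cons.1 hfl.1).1 y (by simp)) (by rw [hxb, hyb]; cases b <;> simp)
      rw [List.length_cons]
      push_cast
      exact (add_le_add_left h1 1).trans (Order.add_one_le_of_lt h2)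
  match l, hl, hlen, hne with
  | [], _, hlen, _ => simp at hlen
  | x :: l, hl, hlen, hne =>
    have h1 := key l x b hl hne
    have hx := hl.2 x (by simp)
    have hpos := hx.pos
    -- As `x` is nonempty, its potential is at most `2k - 3 + (m + 1) = d - 1` in the first branch;
    -- in the second it is at most `m`, and `m < d = 2k + m - 1`.
    have h2 : colorPotential c k m x < (d : ℕ∞) := by
      unfold colorPotential
      split_ifs with h
      · exact_mod_cast (by omega)
      · exact (min_leastColor_lt hc hx h).trans_le (by
          exact_mod_cast (by omega))
    have h3 : (l.length : ℕ∞) = d := by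
      have : l.length = d := by simpa using hlen
      exact_mod_cast this
    exact absurd (h3 ▸ h1) (not_le.2 h2)

/-- The Lovász–Kneser theorem. -/
theorem chromaticNumber_kneserGraph (k m : ℕ) (hk : 1 ≤ k) :
    (kneserGraph (2 * k + m) k).chromaticNumber = (m + 2 : ℕ) := by
  refine le_antisymm ?_ ?_
  · refine SimpleGraph.Colorable.chromaticNumber_le ?_
    have hne : ∀ A : {A : Finset (Fin (2 * k + m)) // A.card = k}, A.1.Nonempty := fun A =>
      Finset.card_pos.1 (by rw [A.2]; exact hk)
    -- Sets are coloured by their least element, truncated at `m + 1`. The sets of the last colour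
    -- lie among the top `2k - 1` points, where no two `k`-sets are disjoint.
    refine ⟨SimpleGraph.Coloring.mk
      (fun A => (⟨min (A.1.min' (hne A)).val (m + 1), by omega⟩ : Fin (m + 2))) ?_⟩
    intro A B hAB he
    have hd := hAB.2
    simp only [Fin.mk.injEq] at he
    have hA := Finset.min'_mem _ (hne A)
    have hB := Finset.min'_mem _ (hne B)
    by_cases h : (A.1.min' (hne A)).val < m + 1
    · have : A.1.min' (hne A) = B.1.min' (hne B) := Fin.ext (by omega)
      exact Finset.disjoint_left.1 hd hA (this ▸ hB)
    · have hsub : (A.1 ∪ B.1).map Fin.valEmbedding ⊆ Finset.Ico (m + 1) (2 * k + m) := by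
        intro a ha
        simp only [Finset.mem_map, Finset.mem_union, Fin.valEmbedding_apply] at ha
        obtain ⟨i, hi, rfl⟩ := ha
        have : m + 1 ≤ i.val := by
          rcases hi with hi | hi
          · have := Fin.le_def.1 (Finset.min'_le _ _ hi); omega
          · have := Fin.le_def.1 (Finset.min'_le _ _ hi); omega
        simp [this]
      have := Finset.card_le_card hsub
      rw [Finset.card_map, Finset.card_union_of_disjoint hd, A.2, B.2, Nat.card_Ico] at this
      omega
  · rw [SimpleGraph.le_chromaticNumber_iff_colorable]
    intro r hr
    by_contra! hlt
    obtain ⟨C⟩ := hr.mono (show r ≤ m + 1 by omega)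
    let f : Finset ℕ → Finset (Fin (2 * k + m)) := fun K => Finset.univ.filter fun i => i.val ∈ K
    have hf : ∀ K ⊆ Finset.range (2 * k + m), K.card = k → (f K).card = k := by
      intro K hK hk
      refine (Finset.card_map Fin.valEmbedding).symm.trans (Eq.trans ?_ hk)
      congr 1
      ext a
      simp only [f, Finset.mem_map, Finset.mem_filter, Finset.mem_univ, true_and,
        Fin.valEmbedding_apply]
      exact ⟨fun ⟨i, hi, h⟩ => h ▸ hi, fun h => ⟨⟨a, Finset.mem_range.1 (hK h)⟩, h, rfl⟩⟩
    obtain ⟨K, hK, hKk, L, hL, hLk, hd, he⟩ := exists_disjoint_same_color (m := m) hk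
      -- The value `0` is a filler: only `k`-subsets of the range are compared.
      (fun K => if h : (f K).card = k then (C ⟨f K, h⟩).val else 0)
      (fun K _ _ => by split_ifs <;> omega)
    simp only [hf K hK hKk, hf L hL hLk, dif_pos] at he
    have hdf : Disjoint (f K) (f L) := by
      rw [Finset.disjoint_left] at hd ⊢
      intro i hi hj
      exact hd (Finset.mem_filter.1 hi).2 (Finset.mem_filter.1 hj).2
    refine C.valid (v := ⟨f K, hf K hK hKk⟩) (w := ⟨f L, hf L hL hLk⟩) ⟨?_, hdf⟩ (Fin.ext he)
    intro h
    rw [Subtype.mk.injEq] at h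
    rw [h, disjoint_self, Finset.bot_eq_empty] at hdf
    have := hf L hL hLk
    rw [hdf, Finset.card_empty] at this
    omega

/-! ### Subdivisions of complete graphs from families of paths -/

/-- A family of odd paths, one for each pair `i < j`, with internal vertices in disjoint sets
yields a totally odd subdivision of a complete graph. -/
lemma containsTotallyOddSubdivision_of_paths {W V : Type*} [LinearOrder W] {G : SimpleGraph V}
    (φ : W → V) (hφ : Function.Injective φ) (D : W → W → Set V)
    (hD : ∀ i j i' j', i < j → i' < j' → ∀ v ∈ D i j, v ∈ D i' j' → i = i' ∧ j = j')
    (hφD : ∀ i j, i < j → ∀ l, φ l ∉ D i j)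
    (hP : ∀ i j, i < j → ∃ p : G.Walk (φ i) (φ j), p.IsPath ∧ Odd p.length ∧
      ∀ v ∈ p.support, v = φ i ∨ v = φ j ∨ v ∈ D i j) :
    ContainsTotallyOddSubdivision (SimpleGraph.completeGraph W) G := by
  choose Q hQpath hQodd hQ using hP
  let P : ∀ u v : W, (SimpleGraph.completeGraph W).Adj u v → G.Walk (φ u) (φ v) := fun u v h =>
    if huv : u < v then Q u v huv else (Q v u (lt_of_le_of_ne (not_lt.1 huv) h.symm)).reverse
  have hP1 : ∀ u v h (huv : u < v), P u v h = Q u v huv := fun u v h huv => dif_pos huv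
  have hP2 : ∀ u v h (huv : v < u), P u v h = (Q v u huv).reverse :=
    fun u v h huv => dif_neg huv.not_gt
  have hcases : ∀ u v, (SimpleGraph.completeGraph W).Adj u v → u < v ∨ v < u :=
    fun u v h => lt_or_gt_of_ne h
  let E : W → W → Set V := fun u v => if u < v then D u v else D v u
  have hsupp : ∀ u v h, ∀ x ∈ (P u v h).support, x = φ u ∨ x = φ v ∨ x ∈ E u v := by
    intro u v h x hx
    rcases hcases u v h with huv | huv
    · rw [hP1 u v h huv] at hx
      simpa [E, huv] using hQ u v huv x hx
    · rw [hP2 u v h huv, SimpleGraph.Walk.support_reverse, List.mem_reverse] at hx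
      have := hQ v u huv x hx
      simp only [E, huv.not_gt, if_false]
      tauto
  have hEφ : ∀ u v, (SimpleGraph.completeGraph W).Adj u v → ∀ l, φ l ∉ E u v := by
    intro u v h l
    rcases hcases u v h with huv | huv
    · simpa [E, huv] using hφD u v huv l
    · simpa [E, huv.not_gt] using hφD v u huv l
  have hEE : ∀ u v u' v', (SimpleGraph.completeGraph W).Adj u v →
      (SimpleGraph.completeGraph W).Adj u' v' → ∀ x ∈ E u v, x ∈ E u' v' →
      s(u, v) = s(u', v') := by
    intro u v u' v' h h' x hx hx'
    rcases hcases u v h with huv | huv <;> rcases hcases u' v' h' with huv' | huv' <;>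
      simp only [E, huv, huv', huv.not_gt, huv'.not_gt, if_true, if_false] at hx hx' <;>
      obtain ⟨h1, h2⟩ := hD _ _ _ _ huv huv' x hx hx' <;> simp [h1, h2, Sym2.eq_swap]
  have hint : ∀ u v h x, IsInternalVertex (P u v h) x → x ∈ E u v := by
    intro u v h x hx
    rcases hsupp u v h x hx.1 with h1 | h1 | h1
    · exact absurd h1 hx.2.1
    · exact absurd h1 hx.2.2
    · exact h1
  refine ⟨φ, P, hφ, ?_, ?_, ?_, ?_, ?_, ?_⟩
  · intro u v h
    rcases hcases u v h with huv | huv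
    · rw [hP1 u v h huv]; exact hQpath u v huv
    · rw [hP2 u v h huv]; exact (hQpath v u huv).reverse
  · intro u v h
    rcases hcases u v h with huv | huv
    · rw [hP1 u v h huv, hP2 v u h.symm huv]
    · rw [hP2 u v h huv, hP1 v u h.symm huv, SimpleGraph.Walk.reverse_reverse]
  · intro u v u' v' h h' hne e he he'
    induction e using Sym2.ind with
    | _ a b =>
      have hab : a ≠ b := (SimpleGraph.Walk.adj_of_mem_edges _ he).ne
      -- A vertex common to two of the paths is a terminal of both. A shared edge would thus join
      -- the ends of both paths, forcing the two pairs to coincide.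
      have hterm : ∀ x ∈ (P u v h).support, x ∈ (P u' v' h').support →
          (x = φ u ∨ x = φ v) ∧ (x = φ u' ∨ x = φ v') := by
        intro x hx hx'
        have h1 := hsupp u v h x hx
        have h2 := hsupp u' v' h' x hx'
        have h3 : x ∈ E u v → x ∉ E u' v' := fun hx hx' => hne (hEE u v u' v' h h' x hx hx')
        have h4 : ∀ l, x = φ l → x ∉ E u v := fun l hl => hl ▸ hEφ u v h l
        have h5 : ∀ l, x = φ l → x ∉ E u' v' := fun l hl => hl ▸ hEφ u' v' h' l
        have := h4 u'; have := h4 v'; have := h5 u; have := h5 v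
        tauto
      obtain ⟨ha, ha'⟩ := hterm a (SimpleGraph.Walk.fst_mem_support_of_mem_edges _ he)
        (SimpleGraph.Walk.fst_mem_support_of_mem_edges _ he')
      obtain ⟨hb, hb'⟩ := hterm b (SimpleGraph.Walk.snd_mem_support_of_mem_edges _ he)
        (SimpleGraph.Walk.snd_mem_support_of_mem_edges _ he')
      have e1 : s(φ u, φ v) = s(a, b) :=
        (Sym2.mem_and_mem_iff hab).1 ⟨Sym2.mem_iff.2 ha, Sym2.mem_iff.2 hb⟩
      have e2 : s(φ u', φ v') = s(a, b) :=
        (Sym2.mem_and_mem_iff hab).1 ⟨Sym2.mem_iff.2 ha', Sym2.mem_iff.2 hb'⟩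
      apply hne
      apply Sym2.map.injective hφ
      rw [Sym2.map_mk, Sym2.map_mk]
      exact e1.trans e2.symm
  · intro u v h w hw
    exact hEφ u v h w (hint u v h _ hw)
  · intro u v u' v' h h' hne x hx
    exact hne (hEE u v u' v' h h' x (hint u v h x hx.1) (hint u' v' h' x hx.2))
  · intro u v h
    rcases hcases u v h with huv | huv
    · rw [hP1 u v h huv]; exact hQodd u v huv
    · rw [hP2 u v h huv, SimpleGraph.Walk.length_reverse]; exact hQodd v u huv

/-! ### Paths in a subdivided cube -/

/-- The vertices `X S` and `M S a` of `G` form a cube with every edge subdivided once, where `M S a`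
subdivides the edge from `S` to `insert a S`, and antipodal vertices of the cube are adjacent. -/
structure IsSubdividedAntipodalCube {I V : Type*} [DecidableEq I] [Fintype I] (G : SimpleGraph V)
    (X : Finset I → V) (M : Finset I → I → V) : Prop where
  adj_lower : ∀ S a, a ∉ S → G.Adj (X S) (M S a)
  adj_upper : ∀ S a, a ∉ S → G.Adj (M S a) (X (insert a S))
  adj_compl : ∀ S, G.Adj (X S) (X Sᶜ)
  injective : Function.Injective X
  mid_injective : ∀ S a T b, a ∉ S → b ∉ T → M S a = M T b → S = T ∧ a = b
  ne_mid : ∀ S T a, a ∉ T → X S ≠ M T a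

/-- The vertices of a subdivided cube that lie in the interval from `A` to `B`. -/
def cubeInterval {I V : Type*} [DecidableEq I] (X : Finset I → V) (M : Finset I → I → V)
    (A B : Finset I) : Set V :=
  {v | (∃ S, A ⊆ S ∧ S ⊆ B ∧ v = X S) ∨
    ∃ S a, a ∉ S ∧ A ⊆ S ∧ insert a S ⊆ B ∧ v = M S a}

section cube
variable {I V : Type*} [DecidableEq I] {X : Finset I → V} {M : Finset I → I → V}

lemma cubeInterval_mono {A A' B B' : Finset I} (hA : A' ⊆ A) (hB : B ⊆ B') :
    cubeInterval X M A B ⊆ cubeInterval X M A' B' := by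
  rintro v (⟨S, h1, h2, rfl⟩ | ⟨S, a, h0, h1, h2, rfl⟩)
  · exact Or.inl ⟨S, hA.trans h1, h2.trans hB, rfl⟩
  · exact Or.inr ⟨S, a, h0, hA.trans h1, h2.trans hB, rfl⟩

variable [Fintype I] {G : SimpleGraph V}

/-- The path climbs by adding the elements of `B \ A` one at a time. Each step passes through a
midpoint, so the parity is kept, and its new vertices lie outside the interval already visited. The
last conclusion allows extensions to be chained, while the one before it locates the new vertices.
-/
lemma IsSubdividedAntipodalCube.exists_extend (h : IsSubdividedAntipodalCube G X M) {u : V}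
    {C A B : Finset I} (hCA : C ⊆ A) (hAB : A ⊆ B) (p : G.Walk u (X A)) (hp : p.IsPath)
    (hpar : Even p.length) (hpA : ∀ v ∈ p.support, v ∈ cubeInterval X M C A) :
    ∃ q : G.Walk u (X B), q.IsPath ∧ Even q.length ∧
      (∀ v ∈ q.support, v ∈ p.support ∨ v ∈ cubeInterval X M A B) ∧
      ∀ v ∈ q.support, v ∈ cubeInterval X M C B := by
  suffices H : ∀ D : Finset I, Disjoint A D → ∃ q : G.Walk u (X (D ∪ A)), q.IsPath ∧
      Even q.length ∧
      (∀ v ∈ q.support, v ∈ p.support ∨ v ∈ cubeInterval X M A (D ∪ A)) ∧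
      ∀ v ∈ q.support, v ∈ cubeInterval X M C (D ∪ A) by
    have := H (B \ A) Finset.disjoint_sdiff
    rwa [Finset.sdiff_union_of_subset hAB] at this
  intro D
  induction D using Finset.induction_on with
  | empty =>
    intro _
    rw [Finset.empty_union]
    exact ⟨p, hp, hpar, fun v hv => Or.inl hv, hpA⟩
  | insert a D haD ih =>
    intro hd
    rw [Finset.disjoint_insert_right] at hd
    obtain ⟨q, hq, heven, hqp, hqC⟩ := ih hd.2
    have ha : a ∉ D ∪ A := by simp [haD, hd.1]
    rw [Finset.insert_union]
    have hM : M (D ∪ A) a ∉ q.support := by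
      intro hm
      rcases hqC _ hm with ⟨S, _, _, hS⟩ | ⟨S, b, hb, _, hSB, hS⟩
      · exact h.ne_mid _ _ _ ha hS.symm
      · obtain ⟨-, rfl⟩ := h.mid_injective _ _ _ _ ha hb hS
        exact ha (hSB (Finset.mem_insert_self _ _))
    have hX : X (insert a (D ∪ A)) ∉ q.support := by
      intro hm
      rcases hqC _ hm with ⟨S, _, hSB, hS⟩ | ⟨S, b, hb, _, _, hS⟩
      · exact ha (hSB (h.injective hS ▸ Finset.mem_insert_self _ _))
      · exact h.ne_mid _ _ _ hb hS
    have hnew : ∀ v, v = M (D ∪ A) a ∨ v = X (insert a (D ∪ A)) →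
        v ∈ cubeInterval X M A (insert a (D ∪ A)) := by
      rintro v (rfl | rfl)
      · exact Or.inr ⟨_, a, ha, Finset.subset_union_right, subset_rfl, rfl⟩
      · exact Or.inl ⟨_, Finset.subset_union_right.trans (Finset.subset_insert _ _), subset_rfl,
          rfl⟩
    refine ⟨(q.concat (h.adj_lower _ a ha)).concat (h.adj_upper _ a ha), ?_, ?_, ?_, ?_⟩
    · refine (hq.concat hM _).concat ?_ _
      simp only [SimpleGraph.Walk.support_concat, List.mem_append, List.mem_singleton, not_or]
      exact ⟨hX, h.ne_mid _ _ _ ha⟩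
    · simp only [SimpleGraph.Walk.length_concat]
      exact (by rw [add_assoc]; exact heven.add (by decide))
    · intro v hv
      simp only [SimpleGraph.Walk.support_concat, List.mem_append, List.mem_singleton] at hv
      rcases hv with (hv | hv) | hv
      · exact (hqp v hv).imp_right fun h => cubeInterval_mono subset_rfl (Finset.subset_insert _ _) h
      · exact Or.inr (hnew v (Or.inl hv))
      · exact Or.inr (hnew v (Or.inr hv))
    · intro v hv
      simp only [SimpleGraph.Walk.support_concat, List.mem_append, List.mem_singleton] at hv
      rcases hv with (hv | hv) | hv
      · exact cubeInterval_mono subset_rfl (Finset.subset_insert _ _) (hqC v hv)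
      · exact cubeInterval_mono hCA subset_rfl (hnew v (Or.inl hv))
      · exact cubeInterval_mono hCA subset_rfl (hnew v (Or.inr hv))

end cube

/-! ### Disjoint links between terminals -/

/-- Coordinates of a cube: one for each terminal, and two marks for each pair of terminals. -/
abbrev LinkCoord (W : Type*) := W ⊕ (W × W) × Bool

/-- `S` carries the mark of `p` and of no other pair. -/
def IsMarked {W : Type*} (p : W × W) (S : Finset (LinkCoord W)) : Prop :=
  .inr (p, true) ∈ S ∧ .inr (p, false) ∉ S ∧
    ∀ p' ≠ p, .inr (p', true) ∈ S → .inr (p', false) ∈ S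

lemma IsMarked.unique {W : Type*} {p p' : W × W} {S : Finset (LinkCoord W)} (h : IsMarked p S)
    (h' : IsMarked p' S) : p = p' := by
  by_contra hne
  exact h'.2.1 (h.2.2 p' (Ne.symm hne) h'.1)

/-- The set of vertices reserved for the path that joins a pair of terminals. -/
def linkRegion {W V : Type*} [DecidableEq W] (X : Finset (LinkCoord W) → V)
    (M : Finset (LinkCoord W) → LinkCoord W → V) (p : W × W) : Set V :=
  {v | (∃ S, IsMarked p S ∧ v = X S) ∨ (∃ S a, a ∉ S ∧ IsMarked p S ∧ v = M S a) ∨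
    v = M {.inl p.1} (.inr (p, true)) ∨ v = X {.inl p.2, .inr (p, false)} ∨
    v = M {.inl p.2} (.inr (p, false))}

lemma mem_linkRegion_of_mem_cubeInterval {W V : Type*} [DecidableEq W]
    {X : Finset (LinkCoord W) → V} {M : Finset (LinkCoord W) → LinkCoord W → V} {p : W × W} {A B : Finset (LinkCoord W)}
    (hm : ∀ S, A ⊆ S → S ⊆ B → IsMarked p S) {v : V} (hv : v ∈ cubeInterval X M A B) :
    v ∈ linkRegion X M p := by
  rcases hv with ⟨S, h1, h2, rfl⟩ | ⟨S, a, h0, h1, h2, rfl⟩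
  · exact Or.inl ⟨S, hm S h1 h2, rfl⟩
  · exact Or.inr (Or.inl ⟨S, a, h0, hm S h1 ((Finset.subset_insert _ _).trans h2), rfl⟩)

section link
variable {W V : Type*} [DecidableEq W] [Fintype W] {X : Finset (LinkCoord W) → V}
  {M : Finset (LinkCoord W) → LinkCoord W → V} {G : SimpleGraph V}

lemma IsSubdividedAntipodalCube.terminal_notMem_linkRegion
    (h : IsSubdividedAntipodalCube G X M) (p : W × W) (l : W) :
    X {.inl l} ∉ linkRegion X M p := by
  rintro (⟨S, hS, he⟩ | ⟨S, a, ha, -, he⟩ | he | he | he)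
  · have := hS.1
    rw [← h.injective he] at this
    simp at this
  · exact h.ne_mid _ _ _ ha he
  · exact h.ne_mid _ _ _ (by simp) he
  · have := h.injective he
    have h2 : (.inr (p, false) : LinkCoord W) ∈ ({.inl l} : Finset (LinkCoord W)) := by
      rw [this]; simp
    simp at h2
  · exact h.ne_mid _ _ _ (by simp) he

/-- A set is marked for at most one pair. The exceptional vertices near the terminals involve sets
without a `true` mark, so they do not meet the marked part, and their coordinate `(p, true)` or `(p,
false)` reveals `p`. -/
lemma IsSubdividedAntipodalCube.linkRegion_unique (h : IsSubdividedAntipodalCube G X M)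
    {p p' : W × W} {v : V} (hv : v ∈ linkRegion X M p) (hv' : v ∈ linkRegion X M p') :
    p = p' := by
  have hX := fun S T (he : X S = X T) => h.injective he
  have hM := h.mid_injective
  have hXM := h.ne_mid
  have hnot : ∀ q q' : W × W, ∀ j : W, ¬ IsMarked q {.inl j, .inr (q', false)} := by
    intro q q' j hq
    have := hq.1
    simp at this
  have hnot' : ∀ q : W × W, ∀ j : W, ¬ IsMarked q {.inl j} := by
    intro q j hq
    have := hq.1
    simp at this
  have hm : ∀ (j : W) (q : W × W) (b : Bool),
      (.inr (q, b) : LinkCoord W) ∉ ({.inl j} : Finset (LinkCoord W)) := by simp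
  rcases hv with ⟨S, hS, rfl⟩ | ⟨S, a, ha, hS, rfl⟩ | rfl | rfl | rfl <;>
    rcases hv' with ⟨T, hT, he⟩ | ⟨T, b, hb, hT, he⟩ | he | he | he
  · exact hS.unique (hX _ _ he ▸ hT)
  · exact absurd he (hXM _ _ _ hb)
  · exact absurd he (hXM _ _ _ (hm _ _ _))
  · exact absurd (hX _ _ he ▸ hS) (hnot _ _ _)
  · exact absurd he (hXM _ _ _ (hm _ _ _))
  · exact absurd he.symm (hXM _ _ _ ha)
  · exact hS.unique ((hM _ _ _ _ ha hb he).1 ▸ hT)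
  · exact absurd ((hM _ _ _ _ ha (hm _ _ _) he).1 ▸ hS) (hnot' _ _)
  · exact absurd he.symm (hXM _ _ _ ha)
  · exact absurd ((hM _ _ _ _ ha (hm _ _ _) he).1 ▸ hS) (hnot' _ _)
  · exact absurd he.symm (hXM _ _ _ (hm _ _ _))
  · exact absurd ((hM _ _ _ _ (hm _ _ _) hb he).1 ▸ hT) (hnot' _ _)
  · have := (hM _ _ _ _ (hm _ _ _) (hm _ _ _) he).2
    simpa using this
  · exact absurd he.symm (hXM _ _ _ (hm _ _ _))
  · have := (hM _ _ _ _ (hm _ _ _) (hm _ _ _) he).2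
    simp at this
  · exact absurd (hX _ _ he ▸ hT) (hnot _ _ _)
  · exact absurd he (hXM _ _ _ hb)
  · exact absurd he (hXM _ _ _ (hm _ _ _))
  · have h1 := hX _ _ he
    have : (.inr (p, false) : LinkCoord W) ∈
        ({.inl p'.2, .inr (p', false)} : Finset (LinkCoord W)) := by rw [← h1]; simp
    simpa using this
  · exact absurd he (hXM _ _ _ (hm _ _ _))
  · exact absurd he.symm (hXM _ _ _ (hm _ _ _))
  · exact absurd ((hM _ _ _ _ (hm _ _ _) hb he).1 ▸ hT) (hnot' _ _)
  · have := (hM _ _ _ _ (hm _ _ _) (hm _ _ _) he).2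
    simp at this
  · exact absurd he.symm (hXM _ _ _ (hm _ _ _))
  · have := (hM _ _ _ _ (hm _ _ _) (hm _ _ _) he).2
    simpa using this

/-- In this stage of the climb no other pair has its `true` mark, while the `false` marks of all
other pairs are being collected. Once they are all present, any `true` marks of other pairs are
harmless. -/
lemma isMarked_of_cubeInterval_lower {p : W × W} {S : Finset (LinkCoord W)}
    (h1 : {.inl p.1, .inr (p, true)} ⊆ S)
    (h2 : S ⊆ Finset.univ.filter fun a => a = .inl p.1 ∨ a = .inr (p, true) ∨
      ∃ p' ≠ p, a = .inr (p', false)) : IsMarked p S := by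
  refine ⟨h1 (by simp), fun h => ?_, fun p' hp' h => ?_⟩
  · rcases (Finset.mem_filter.1 (h2 h)).2 with h | h | ⟨p', hp', h⟩
    · simp at h
    · simp at h
    · exact hp' (by simpa using h.symm)
  · exact absurd (h2 h) (by simp [hp'])

lemma isMarked_of_cubeInterval_upper {p : W × W} {S : Finset (LinkCoord W)}
    (h1 : (Finset.univ.filter fun a => a = .inl p.1 ∨ a = .inr (p, true) ∨
      ∃ p' ≠ p, a = .inr (p', false)) ⊆ S)
    (h2 : S ⊆ ({.inl p.2, .inr (p, false)} : Finset (LinkCoord W))ᶜ) : IsMarked p S := by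
  refine ⟨h1 (by simp), fun h => ?_, fun p' hp' _ =>
    h1 (Finset.mem_filter.2 ⟨Finset.mem_univ _, Or.inr (Or.inr ⟨p', hp', rfl⟩)⟩)⟩
  simpa using h2 h

/-- The path climbs in three stages to the complement of `{.inl p.2, .inr (p, false)}`, crosses one
antipodal edge and descends by one cube step to `{.inl p.2}`. Everything but the antipodal edge has
even length. -/
lemma IsSubdividedAntipodalCube.exists_link (h : IsSubdividedAntipodalCube G X M) {p : W × W}
    (hp : p.1 ≠ p.2) : ∃ q : G.Walk (X {.inl p.1}) (X {.inl p.2}), q.IsPath ∧ Odd q.length ∧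
      ∀ v ∈ q.support, v = X {.inl p.1} ∨ v = X {.inl p.2} ∨ v ∈ linkRegion X M p := by
  set A₁ : Finset (LinkCoord W) := {.inl p.1, .inr (p, true)} with hA₁
  set A₂ : Finset (LinkCoord W) := Finset.univ.filter fun a => a = .inl p.1 ∨ a = .inr (p, true) ∨
      ∃ p' ≠ p, a = .inr (p', false) with hA₂
  set A₃ : Finset (LinkCoord W) := ({.inl p.2, .inr (p, false)} : Finset (LinkCoord W))ᶜ with hA₃
  have h01 : ({.inl p.1} : Finset (LinkCoord W)) ⊆ A₁ := by simp [hA₁]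
  have h12 : A₁ ⊆ A₂ := by
    intro a ha
    simp only [hA₁, Finset.mem_insert, Finset.mem_singleton] at ha
    simp only [hA₂, Finset.mem_filter, Finset.mem_univ, true_and]
    tauto
  have h23 : A₂ ⊆ A₃ := by
    intro a ha
    simp only [hA₂, Finset.mem_filter, Finset.mem_univ, true_and] at ha
    simp only [hA₃, Finset.mem_compl, Finset.mem_insert, Finset.mem_singleton]
    rcases ha with rfl | rfl | ⟨p', hp', rfl⟩
    · simp [hp]
    · simp
    · simp [hp']
  obtain ⟨q₁, hq₁, ho₁, hs₁, hc₁⟩ := h.exists_extend (C := {.inl p.1}) subset_rfl h01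
    SimpleGraph.Walk.nil (by simp) (by simp)
    (fun v hv => Or.inl ⟨_, subset_rfl, subset_rfl, by simpa using hv⟩)
  obtain ⟨q₂, hq₂, ho₂, hs₂, hc₂⟩ := h.exists_extend h01 h12 q₁ hq₁ ho₁ hc₁
  obtain ⟨q₃, hq₃, ho₃, hs₃, hc₃⟩ := h.exists_extend (h01.trans h12) h23 q₂ hq₂ ho₂ hc₂
  have hregion : ∀ v ∈ q₃.support, v = X {.inl p.1} ∨ v ∈ linkRegion X M p := by
    intro v hv
    rcases hs₃ v hv with hv | hv
    swap
    · exact Or.inr (mem_linkRegion_of_mem_cubeInterval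
        (fun S h1 h2 => isMarked_of_cubeInterval_upper h1 h2) hv)
    rcases hs₂ v hv with hv | hv
    swap
    · exact Or.inr (mem_linkRegion_of_mem_cubeInterval
        (fun S h1 h2 => isMarked_of_cubeInterval_lower h1 h2) hv)
    have hmark : IsMarked p A₁ := isMarked_of_cubeInterval_lower subset_rfl h12
    have hA₁' : A₁ = insert (.inr (p, true)) {.inl p.1} := Finset.pair_comm _ _
    -- The first stage is a single cube edge, so its interval holds only two cube vertices and one
    -- midpoint.
    rcases hs₁ v hv with hv | ⟨S, h1, h2, rfl⟩ | ⟨S, a, h0, h1, h2, rfl⟩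
    · exact Or.inl (by simpa using hv)
    · by_cases hx : (.inr (p, true) : LinkCoord W) ∈ S
      · have : S = A₁ := h2.antisymm (by
          rw [hA₁']; exact Finset.insert_subset hx h1)
        exact Or.inr (Or.inl ⟨A₁, hmark, by rw [this]⟩)
      · left
        rw [hA₁', Finset.subset_insert_iff, Finset.erase_eq_of_notMem hx] at h2
        rw [h2.antisymm h1]
    · have ha : a = .inr (p, true) := by
        have h3 := h2 (Finset.mem_insert_self _ _)
        simp only [hA₁, Finset.mem_insert, Finset.mem_singleton] at h3
        rcases h3 with rfl | h3
        · exact absurd (h1 (Finset.mem_singleton_self _)) h0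
        · exact h3
      subst ha
      have hS : S = {.inl p.1} := by
        have h3 := (Finset.subset_insert _ _).trans h2
        rw [hA₁', Finset.subset_insert_iff, Finset.erase_eq_of_notMem h0] at h3
        exact h3.antisymm h1
      rw [hS]
      exact Or.inr (Or.inr (Or.inr (Or.inl rfl)))
  -- All sets met on the climb contain `.inl p.1` and none after the antipodal edge does, so the
  -- path does not meet itself.
  have hXs : ∀ S : Finset (LinkCoord W), .inl p.1 ∉ S → X S ∉ q₃.support := by
    intro S hS hm
    rcases hc₃ _ hm with ⟨T, h1, _, he⟩ | ⟨T, a, h0, _, _, he⟩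
    · exact hS (h.injective he ▸ h1 (Finset.mem_singleton_self _))
    · exact h.ne_mid _ _ _ h0 he
  have hMs : ∀ (S : Finset (LinkCoord W)) (a), a ∉ S → .inl p.1 ∉ S → M S a ∉ q₃.support := by
    intro S a ha hS hm
    rcases hc₃ _ hm with ⟨T, _, _, he⟩ | ⟨T, b, h0, h1, _, he⟩
    · exact h.ne_mid _ _ _ ha he.symm
    · exact hS ((h.mid_injective _ _ _ _ ha h0 he).1 ▸ h1 (Finset.mem_singleton_self _))
  have hy : (.inr (p, false) : LinkCoord W) ∉ ({.inl p.2} : Finset (LinkCoord W)) := by simp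
  have hA₄ : ({.inl p.2, .inr (p, false)} : Finset (LinkCoord W)) =
    insert (.inr (p, false)) {.inl p.2} := Finset.pair_comm _ _
  have e₁ : G.Adj (X A₃) (X {.inl p.2, .inr (p, false)}) := (by
    have := h.adj_compl A₃
    rwa [hA₃, compl_compl] at this)
  have e₂ : G.Adj (X {.inl p.2, .inr (p, false)}) (M {.inl p.2} (.inr (p, false))) := (by
    rw [hA₄]; exact (h.adj_upper _ _ hy).symm)
  have e₃ : G.Adj (M {.inl p.2} (.inr (p, false))) (X {.inl p.2}) := (h.adj_lower _ _ hy).symm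
  refine ⟨((q₃.concat e₁).concat e₂).concat e₃, ?_, ?_, ?_⟩
  · refine ((hq₃.concat (hXs _ (by simp [hp])) _).concat ?_ _).concat ?_ _
    · simp only [SimpleGraph.Walk.support_concat, List.mem_append, List.mem_singleton, not_or]
      exact ⟨hMs _ _ hy (by simp [hp]), (h.ne_mid _ _ _ hy).symm⟩
    · simp only [SimpleGraph.Walk.support_concat, List.mem_append, List.mem_singleton, not_or]
      refine ⟨⟨hXs _ (by simp [hp]), fun he => ?_⟩, h.ne_mid _ _ _ hy⟩
      apply hy
      rw [h.injective he]
      simp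
  · simp only [SimpleGraph.Walk.length_concat]
    exact (by rw [add_assoc, add_assoc]; exact ho₃.add_odd (by decide))
  · intro v hv
    simp only [SimpleGraph.Walk.support_concat, List.mem_append, List.mem_singleton] at hv
    rcases hv with ((hv | rfl) | rfl) | rfl
    · have := hregion v hv
      tauto
    · exact Or.inr (Or.inr (Or.inr (Or.inr (Or.inr (Or.inl rfl)))))
    · exact Or.inr (Or.inr (Or.inr (Or.inr (Or.inr (Or.inr rfl)))))
    · exact Or.inr (Or.inl rfl)

end link

/-- A graph that contains a sufficiently large subdivided cube with antipodal edges contains a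
totally odd subdivision of a complete graph. -/
theorem IsSubdividedAntipodalCube.containsTotallyOddSubdivision {W V : Type*} [LinearOrder W]
    [Fintype W] {G : SimpleGraph V} {X : Finset (LinkCoord W) → V}
    {M : Finset (LinkCoord W) → LinkCoord W → V} (h : IsSubdividedAntipodalCube G X M) :
    ContainsTotallyOddSubdivision (SimpleGraph.completeGraph W) G := by
  refine containsTotallyOddSubdivision_of_paths (fun i => X {.inl i}) ?_
    (fun i j => linkRegion X M (i, j)) ?_ ?_ ?_
  · intro i j hij
    simpa using h.injective hij
  · intro i j i' j' _ _ v hv hv'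
    simpa using h.linkRegion_unique hv hv'
  · exact fun i j _ l => h.terminal_notMem_linkRegion (i, j) l
  · exact fun i j hij => h.exists_link (p := (i, j)) hij.ne

/-! ### Subdivided cubes in Kneser graphs -/

section cubeInKneser
variable {I : Type*} [DecidableEq I] [Fintype I] {r : ℕ}

/-- The vertex of a cube, as a transversal of the pairs `{(a, false), (a, true)}`. -/
def cubeVertex (r : ℕ) (S : Finset I) : Finset (I × Bool ⊕ Fin r) :=
  Finset.univ.map ⟨fun a => .inl (a, decide (a ∈ S)), fun a b h => by simp_all⟩

/-- A set disjoint from the transversals of `S` and of `insert a S`. -/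
def cubeMidpoint (z : Fin r) (S : Finset I) (a : I) : Finset (I × Bool ⊕ Fin r) :=
  insert (.inr z) ((Finset.univ.erase a).map
    ⟨fun b => .inl (b, !decide (b ∈ S)), fun a b h => by simp_all⟩)

@[simp] lemma inl_mem_cubeVertex {S : Finset I} {b : I} {c : Bool} :
    .inl (b, c) ∈ cubeVertex r S ↔ c = decide (b ∈ S) := by
  rw [cubeVertex, Finset.mem_map]
  constructor
  · rintro ⟨a, -, h⟩
    have h' : (.inl (a, decide (a ∈ S)) : I × Bool ⊕ Fin r) = .inl (b, c) := h
    cases h'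
    rfl
  · rintro rfl
    exact ⟨b, Finset.mem_univ b, rfl⟩

@[simp] lemma inr_notMem_cubeVertex {S : Finset I} {y : Fin r} : .inr y ∉ cubeVertex r S := by
  simp [cubeVertex]

@[simp] lemma inl_mem_cubeMidpoint {z : Fin r} {S : Finset I} {a b : I} {c : Bool} :
    .inl (b, c) ∈ cubeMidpoint z S a ↔ b ≠ a ∧ c = !decide (b ∈ S) := by
  simp only [cubeMidpoint, Finset.mem_insert, reduceCtorEq, false_or]
  rw [Finset.mem_map]
  constructor
  · rintro ⟨d, hd, h⟩
    have h' : (.inl (d, !decide (d ∈ S)) : I × Bool ⊕ Fin r) = .inl (b, c) := h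
    cases h'
    exact ⟨Finset.ne_of_mem_erase hd, rfl⟩
  · rintro ⟨hb, rfl⟩
    exact ⟨b, Finset.mem_erase.2 ⟨hb, Finset.mem_univ b⟩, rfl⟩

@[simp] lemma inr_mem_cubeMidpoint {z y : Fin r} {S : Finset I} {a : I} :
    .inr y ∈ cubeMidpoint z S a ↔ y = z := by
  simp [cubeMidpoint]

lemma card_cubeVertex (S : Finset I) : (cubeVertex r S).card = Fintype.card I := by
  simp [cubeVertex]

lemma card_cubeMidpoint (z : Fin r) (S : Finset I) (a : I) :
    (cubeMidpoint z S a).card = Fintype.card I := by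
  have : 0 < Fintype.card I := Fintype.card_pos_iff.2 ⟨a⟩
  rw [cubeMidpoint, Finset.card_insert_of_notMem (by simp), Finset.card_map,
    Finset.card_erase_of_mem (Finset.mem_univ a), Finset.card_univ]
  omega

lemma cubeVertex_injective : Function.Injective (cubeVertex r : Finset I → _) := by
  intro S T h
  ext b
  have := Finset.ext_iff.1 h (.inl (b, true))
  simpa using this

/-- The pair that the midpoint misses reveals `a`. The midpoint cannot see whether `a` belongs to
`S`, which is why `a ∉ S` and `b ∉ T` are required. -/
lemma cubeMidpoint_injective {z : Fin r} {S T : Finset I} {a b : I} (ha : a ∉ S) (hb : b ∉ T)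
    (h : cubeMidpoint z S a = cubeMidpoint z T b) : S = T ∧ a = b := by
  have key : ∀ i c, (i ≠ a ∧ c = !decide (i ∈ S)) ↔ (i ≠ b ∧ c = !decide (i ∈ T)) := by
    intro i c
    simpa using Finset.ext_iff.1 h (.inl (i, c))
  have hab : a = b := by
    by_contra hne
    exact ((key a (!decide (a ∈ T))).2 ⟨hne, rfl⟩).1 rfl
  subst hab
  refine ⟨?_, rfl⟩
  ext i
  by_cases hi : i = a
  · simp [hi, ha, hb]
  · have := key i false
    simpa [hi] using this

lemma disjoint_cubeVertex_cubeMidpoint (z : Fin r) (S : Finset I) (a : I) :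
    Disjoint (cubeVertex r S) (cubeMidpoint z S a) := by
  rw [Finset.disjoint_left]
  rintro (⟨b, c⟩ | y)
  · simp only [inl_mem_cubeVertex, inl_mem_cubeMidpoint]
    rintro rfl
    simp
  · simp

/-- The two transversals differ only in the pair at `a`, which the midpoint avoids. -/
lemma disjoint_cubeVertex_insert_cubeMidpoint (z : Fin r) (S : Finset I) (a : I) :
    Disjoint (cubeVertex r (insert a S)) (cubeMidpoint z S a) := by
  rw [Finset.disjoint_left]
  rintro (⟨b, c⟩ | y)
  · simp only [inl_mem_cubeVertex, inl_mem_cubeMidpoint]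
    rintro rfl ⟨hb, h⟩
    simp [hb] at h
  · simp

lemma disjoint_cubeVertex_compl (S : Finset I) :
    Disjoint (cubeVertex r S) (cubeVertex r Sᶜ) := by
  rw [Finset.disjoint_left]
  rintro (⟨b, c⟩ | y)
  · simp
  · simp

/-- `KG(2k + r, k)` contains the subdivided `k`-cube with antipodal edges if `k, r ≥ 1`. -/
theorem exists_isSubdividedAntipodalCube [Nonempty I] (hr : 1 ≤ r) :
    ∃ X M, IsSubdividedAntipodalCube (I := I)
      (kneserGraph (2 * Fintype.card I + r) (Fintype.card I)) X M := by
  let z : Fin r := ⟨0, hr⟩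
  let e : (I × Bool ⊕ Fin r) ≃ Fin (2 * Fintype.card I + r) :=
    Fintype.equivFinOfCardEq (by simp [mul_comm])
  have hpos : 0 < Fintype.card I := Fintype.card_pos
  have hadj : ∀ A B : {A : Finset (Fin (2 * Fintype.card I + r)) // A.card = Fintype.card I},
      Disjoint A.1 B.1 → (kneserGraph _ _).Adj A B := by
    refine fun A B hd => ⟨?_, hd⟩
    rintro rfl
    rw [disjoint_self, Finset.bot_eq_empty] at hd
    have := A.2
    rw [hd, Finset.card_empty] at this
    omega
  have hinj := Finset.map_injective e.toEmbedding
  refine ⟨fun S => ⟨(cubeVertex r S).map e.toEmbedding, by rw [Finset.card_map, card_cubeVertex]⟩,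
    fun S a => ⟨(cubeMidpoint z S a).map e.toEmbedding, by
      rw [Finset.card_map, card_cubeMidpoint]⟩, ?_, ?_, ?_, ?_, ?_, ?_⟩
  · exact fun S a _ => hadj _ _ ((Finset.disjoint_map _).2 (disjoint_cubeVertex_cubeMidpoint z S a))
  · exact fun S a _ => hadj _ _ ((Finset.disjoint_map _).2
      (disjoint_cubeVertex_insert_cubeMidpoint z S a).symm)
  · exact fun S => hadj _ _ ((Finset.disjoint_map _).2 (disjoint_cubeVertex_compl S))
  · exact fun S T h => cubeVertex_injective (hinj (Subtype.ext_iff.1 h))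
  · exact fun S a T b ha hb h => cubeMidpoint_injective ha hb (hinj (Subtype.ext_iff.1 h))
  · intro S T a _ h
    have h1 : cubeVertex r S = cubeMidpoint z T a := hinj (Subtype.ext_iff.1 h)
    exact inr_notMem_cubeVertex (h1 ▸ inr_mem_cubeMidpoint.2 rfl)

end cubeInKneser

theorem mainTheorem2 (s t : ℕ) (hs : 8 ≤ s) (ht : 1 ≤ t) :
    ∃ n k : ℕ, 1 ≤ k ∧ k ≤ n ∧ (kneserGraph n k).chromaticNumber = (s : ℕ∞) ∧
      ContainsTotallyOddSubdivision (SimpleGraph.completeGraph (Fin t)) (kneserGraph n k) := by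
  obtain ⟨m, rfl⟩ : ∃ m, s = m + 2 := ⟨s - 2, by omega⟩
  have : Nonempty (LinkCoord (Fin t)) := ⟨.inl ⟨0, ht⟩⟩
  have hk : 1 ≤ Fintype.card (LinkCoord (Fin t)) := Fintype.card_pos
  -- The cube dimension is `k`, the number of link coordinates; the `m = s - 2` spare points fix the
  -- chromatic number and supply the extra point of the midpoints.
  obtain ⟨X, M, h⟩ := exists_isSubdividedAntipodalCube (I := LinkCoord (Fin t)) (r := m) (by omega)
  exact ⟨_, _, hk, by omega, chromaticNumber_kneserGraph _ m hk, h.containsTotallyOddSubdivision⟩
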